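/- Let $F_\infty$ be the free group on $x_1,x_2,\dots$. Outer commutator words are the elements of $F_\infty$ defined inductively: each variable $x_i$ is one, and if $u$ and $v$ are outer commutator words in disjoint sets of variables, then so is $[u,v]=u^{-1}v^{-1}uv$. Let $V\subseteq F_\infty$ be any set of outer commutator words and let $\mathcal V$ be the variety of groups defined by the laws $V$. For a group $F$ put $T(F)=\{v(f_1,\dots,f_s) : v\in V,\ f_i\in F\}$ and let $V(F)=\langle T(F)\rangle$ be the verbal subgroup. For a group $G$ with a free presentation $G\cong F/R$ ($F$ a free group, $R$ a normal subgroup of $F$) put $$\mathcal V\tilde B_0(G)=\frac{R\cap V(F)}{\langle T(F)\cap R\rangle}.$$ Then for all groups $G_1$ and $G_2$, $$\mathcal V\tilde B_0(G_1\times G_2)\cong \mathcal V\tilde B_0(G_1)\times\mathcal V\tilde B_0(G_2),$$ whichever free presentations of $G_1$, $G_2$ and $G_1\times G_2$ are used to form the three groups. -/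

import Mathlib

namespace BogomolovInvariant

/-- `IsOuterCommutatorWord S w`: the element `w` of the free group on `x₀, x₁, …` is an outer
commutator word whose variables are exactly those indexed by `S` (so its weight is `S.card`).
A single variable is one, and so is `[u, v] = u⁻¹v⁻¹uv` for outer commutator words `u`, `v` in
disjoint sets of variables. -/
inductive IsOuterCommutatorWord : Finset ℕ → FreeGroup ℕ → Prop
  | var (i : ℕ) : IsOuterCommutatorWord {i} (FreeGroup.of i)
  | comm {S T : Finset ℕ} {u v : FreeGroup ℕ} (hu : IsOuterCommutatorWord S u)
      (hv : IsOuterCommutatorWord T v) (hST : Disjoint S T) :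
      IsOuterCommutatorWord (S ∪ T) (u⁻¹ * v⁻¹ * u * v)

/-- The set `T(F) = {v(f₁, …, fₛ) | v ∈ V, fᵢ ∈ F}` of values in `F` of the words in `V`. -/
def wordValues (V : Set (FreeGroup ℕ)) (F : Type*) [Group F] : Set F :=
  {x | ∃ v ∈ V, ∃ f : ℕ → F, x = FreeGroup.lift f v}

/-- The verbal subgroup `V(F)`, generated by all values in `F` of the words in `V`. -/
def verbalSubgroup (V : Set (FreeGroup ℕ)) (F : Type*) [Group F] : Subgroup F :=
  Subgroup.closure (wordValues V F)

/-- The subgroup `⟨T(F) ∩ R⟩` of `F`. -/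
def valuesIn (V : Set (FreeGroup ℕ)) {F : Type*} [Group F] (R : Subgroup F) : Subgroup F :=
  Subgroup.closure (wordValues V F ∩ (R : Set F))

theorem conj_mem_wordValues (V : Set (FreeGroup ℕ)) {F : Type*} [Group F] {x : F}
    (hx : x ∈ wordValues V F) (g : F) : g * x * g⁻¹ ∈ wordValues V F := by
  obtain ⟨v, hv, f, rfl⟩ := hx
  refine ⟨v, hv, fun i => g * f i * g⁻¹, ?_⟩
  have h : (MulAut.conj g).toMonoidHom.comp (FreeGroup.lift f)
      = FreeGroup.lift (fun i => g * f i * g⁻¹) := by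
    ext i
    simp
  simpa using DFunLike.congr_fun h v

instance valuesIn_normal (V : Set (FreeGroup ℕ)) {F : Type*} [Group F] (R : Subgroup F)
    [hR : R.Normal] : (valuesIn V R).Normal := by
  refine ⟨fun x hx g => ?_⟩
  have h : valuesIn V R ≤ (valuesIn V R).comap (MulAut.conj g).toMonoidHom := by
    refine (Subgroup.closure_le _).2 fun y hy => ?_
    exact Subgroup.subset_closure ⟨conj_mem_wordValues V hy.1 g, hR.conj_mem y hy.2 g⟩
  simpa using h hx

/-- The group `(R ∩ V(F)) / ⟨T(F) ∩ R⟩` attached to a normal subgroup `R` of `F`. For `F` free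
this is the `B̃₀`-invariant of `F / R` with respect to `V`. (Note that `⟨T(F) ∩ R⟩` is contained
in `R ∩ V(F)`.) -/
abbrev BTilde (V : Set (FreeGroup ℕ)) {F : Type*} [Group F] (R : Subgroup F) [R.Normal] : Type _ :=
  ↥(R ⊓ verbalSubgroup V F) ⧸ (valuesIn V R).subgroupOf (R ⊓ verbalSubgroup V F)

end BogomolovInvariant

/-! Fix `R` normal in `F`. Modulo `⟨T(F) ∩ R⟩`, an outer commutator word sees its entries only
modulo `R` (`mk_lift_congr`). By induction on `[u, v]`, the `u`-value changes by a product of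
`u`-values in `R` and their inverses. If `n` is a `u`-value in `R` and `y` is a `v`-value, then `[n,
y]` lies in `R` and is itself a `[u, v]`-value, hence dies. The same argument makes the word
multiplicative across subgroups that commute modulo `R` (`mk_lift_mul`).

So homomorphisms that agree modulo `R` agree on verbal subgroups modulo `⟨T ∩ R⟩` (`mk_map_congr`).
Freeness lifts the projections and inclusions of `G₁ × G₂` to `αᵢ : F → Fᵢ` and `βᵢ : Fᵢ → F`. The
usual product identities hold modulo the kernels. On verbal subgroups they hold modulo `⟨T ∩ R⟩`, so
`(α₁, α₂)` induces the isomorphism. -/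

namespace BogomolovInvariant

/-! ### Commutator identities under commuting hypotheses -/

section Commutators

variable {Q : Type*} [Group Q]

theorem comm_mul_left_eq {u n w : Q} (h₁ : Commute n w) (h₂ : Commute n (u⁻¹ * w * u)) :
    (u * n)⁻¹ * w⁻¹ * (u * n) * w = u⁻¹ * w⁻¹ * u * w := by
  have h₃ : Commute n (u⁻¹ * w⁻¹ * u) := by
    have := h₂.inv_right
    simpa [mul_assoc] using this
  calc (u * n)⁻¹ * w⁻¹ * (u * n) * w = n⁻¹ * (u⁻¹ * w⁻¹ * u) * (n * w) := by group
    _ = n⁻¹ * ((u⁻¹ * w⁻¹ * u) * w * n) := by rw [h₁.eq]; group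
    _ = n⁻¹ * (n * ((u⁻¹ * w⁻¹ * u) * w)) := by rw [(h₃.mul_right h₁).eq]
    _ = u⁻¹ * w⁻¹ * u * w := by group

theorem comm_mul_right_eq {u w m : Q} (h : Commute m (w⁻¹ * u * w)) :
    u⁻¹ * (w * m)⁻¹ * u * (w * m) = u⁻¹ * w⁻¹ * u * w := by
  calc u⁻¹ * (w * m)⁻¹ * u * (w * m) = u⁻¹ * m⁻¹ * ((w⁻¹ * u * w) * m) := by group
    _ = u⁻¹ * m⁻¹ * (m * (w⁻¹ * u * w)) := by rw [h.eq]
    _ = u⁻¹ * w⁻¹ * u * w := by group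

/-- The hypotheses make both `u'` and `w'` commute with `[u, w]`, which can then be pulled to the
front. -/
theorem comm_mul_mul_eq {u u' w w' : Q} (h₁ : Commute u w') (h₂ : Commute u' w)
    (h₃ : Commute (w⁻¹ * u * w) w') (h₄ : Commute (u⁻¹ * w * u) u') :
    (u * u')⁻¹ * (w * w')⁻¹ * (u * u') * (w * w') =
      (u⁻¹ * w⁻¹ * u * w) * (u'⁻¹ * w'⁻¹ * u' * w') := by
  have k₁ : Commute w' (u⁻¹ * w⁻¹ * u * w) := by
    have := h₁.inv_left.symm.mul_right h₃.symm
    simpa [mul_assoc] using this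
  have k₂ : Commute u' (u⁻¹ * w⁻¹ * u * w) := by
    have := h₄.inv_left.symm.mul_right h₂
    simpa [mul_assoc] using this
  have k₃ : Commute w'⁻¹ u⁻¹ := h₁.inv_left.inv_right.symm
  calc (u * u')⁻¹ * (w * w')⁻¹ * (u * u') * (w * w')
      = u'⁻¹ * (u⁻¹ * w'⁻¹) * w⁻¹ * u * (u' * w) * w' := by group
    _ = u'⁻¹ * w'⁻¹ * ((u⁻¹ * w⁻¹ * u * w) * (u' * w')) := by
        rw [← k₃.eq, h₂.eq]; group
    _ = u'⁻¹ * (w'⁻¹ * (u⁻¹ * w⁻¹ * u * w)) * (u' * w') := by group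
    _ = (u'⁻¹ * (u⁻¹ * w⁻¹ * u * w)) * w'⁻¹ * (u' * w') := by rw [k₁.inv_left.eq]; group
    _ = (u⁻¹ * w⁻¹ * u * w) * (u'⁻¹ * w'⁻¹ * u' * w') := by rw [k₂.inv_left.eq]; group

end Commutators

/-! ### Values of outer commutator words modulo `⟨T(F) ∩ R⟩` -/

section Values

variable {F : Type*} [Group F]

theorem lift_mem_wordValues {V : Set (FreeGroup ℕ)} {v : FreeGroup ℕ} (hv : v ∈ V) (f : ℕ → F) :
    FreeGroup.lift f v ∈ wordValues V F :=
  ⟨v, hv, f, rfl⟩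

theorem map_lift {H : Type*} [Group H] (φ : F →* H) (f : ℕ → F) (v : FreeGroup ℕ) :
    φ (FreeGroup.lift f v) = FreeGroup.lift (fun i => φ (f i)) v := by
  have h : φ.comp (FreeGroup.lift f) = FreeGroup.lift (fun i => φ (f i)) := by
    ext i
    simp
  exact DFunLike.congr_fun h v

theorem lift_mem_of_forall_mem (A : Subgroup F) {f : ℕ → F} (hf : ∀ i, f i ∈ A)
    (v : FreeGroup ℕ) : FreeGroup.lift f v ∈ A := by
  have h := map_lift A.subtype (fun i => (⟨f i, hf i⟩ : A)) v
  exact h ▸ (FreeGroup.lift (fun i => (⟨f i, hf i⟩ : A)) v).2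

theorem map_mem_wordValues {V : Set (FreeGroup ℕ)} {H : Type*} [Group H] (φ : F →* H) {x : F}
    (hx : x ∈ wordValues V F) : φ x ∈ wordValues V H := by
  obtain ⟨v, hv, f, rfl⟩ := hx
  exact ⟨v, hv, _, map_lift φ f v⟩

theorem map_mem_verbalSubgroup {V : Set (FreeGroup ℕ)} {H : Type*} [Group H] (φ : F →* H) {x : F}
    (hx : x ∈ verbalSubgroup V F) : φ x ∈ verbalSubgroup V H := by
  have h : verbalSubgroup V F ≤ (verbalSubgroup V H).comap φ :=
    (Subgroup.closure_le _).2 fun y hy => Subgroup.subset_closure (map_mem_wordValues φ hy)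
  exact h hx

theorem map_mem_valuesIn {V : Set (FreeGroup ℕ)} {H : Type*} [Group H] (φ : F →* H)
    {R : Subgroup F} {R' : Subgroup H} (hR : R ≤ R'.comap φ) {x : F}
    (hx : x ∈ valuesIn V R) : φ x ∈ valuesIn V R' := by
  have h : valuesIn V R ≤ (valuesIn V R').comap φ :=
    (Subgroup.closure_le _).2 fun y hy =>
      Subgroup.subset_closure ⟨map_mem_wordValues φ hy.1, hR hy.2⟩
  exact h hx

theorem valuesIn_le_verbalSubgroup (V : Set (FreeGroup ℕ)) (R : Subgroup F) :
    valuesIn V R ≤ verbalSubgroup V F :=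
  Subgroup.closure_mono Set.inter_subset_left

theorem valuesIn_mono {V W : Set (FreeGroup ℕ)} (h : V ⊆ W) (R : Subgroup F) :
    valuesIn V R ≤ valuesIn W R :=
  Subgroup.closure_mono fun _ ⟨⟨v, hv, f, hx⟩, hR⟩ => ⟨⟨v, h hv, f, hx⟩, hR⟩

instance verbalSubgroup_normal (V : Set (FreeGroup ℕ)) : (verbalSubgroup V F).Normal :=
  ⟨fun _ hx g => map_mem_verbalSubgroup (MulAut.conj g).toMonoidHom hx⟩

theorem lift_congr_of_eqOn {S : Finset ℕ} {w : FreeGroup ℕ} (hw : IsOuterCommutatorWord S w)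
    {f g : ℕ → F} (h : ∀ i ∈ S, f i = g i) : FreeGroup.lift f w = FreeGroup.lift g w := by
  induction hw with
  | var i => simpa using h i (by simp)
  | comm _ _ _ ihu ihv =>
    simp only [map_mul, map_inv]
    rw [ihu fun i hi => h i (Finset.mem_union_left _ hi),
      ihv fun i hi => h i (Finset.mem_union_right _ hi)]

section Step

variable {S T : Finset ℕ} {u w : FreeGroup ℕ} (hu : IsOuterCommutatorWord S u)
  (hw : IsOuterCommutatorWord T w) (hST : Disjoint S T)
include hu hw hST

/-- Disjointness of the variables lets the two substitutions be glued into one. -/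
theorem comm_mem_wordValues {x y : F} (hx : x ∈ wordValues {u} F) (hy : y ∈ wordValues {w} F) :
    x⁻¹ * y⁻¹ * x * y ∈ wordValues {u⁻¹ * w⁻¹ * u * w} F := by
  obtain ⟨_, rfl, f, rfl⟩ := hx
  obtain ⟨_, rfl, g, rfl⟩ := hy
  refine ⟨_, rfl, fun i => if i ∈ S then f i else g i, ?_⟩
  simp only [map_mul, map_inv]
  rw [lift_congr_of_eqOn hu (f := fun i => if i ∈ S then f i else g i) (g := f)
      fun i hi => if_pos hi,
    lift_congr_of_eqOn hw (f := fun i => if i ∈ S then f i else g i) (g := g)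
      fun i hi => if_neg (Finset.disjoint_right.1 hST hi)]

variable (R : Subgroup F) [hR : R.Normal]

theorem commute_mk_of_comm_mem {x y : F} (hx : x ∈ wordValues {u} F) (hy : y ∈ wordValues {w} F)
    (h : x⁻¹ * y⁻¹ * x * y ∈ R) :
    Commute (x : F ⧸ valuesIn {u⁻¹ * w⁻¹ * u * w} R) y := by
  have h' : x⁻¹ * y⁻¹ * x * y ∈ valuesIn {u⁻¹ * w⁻¹ * u * w} R :=
    Subgroup.subset_closure ⟨comm_mem_wordValues hu hw hST hx hy, h⟩
  refine (QuotientGroup.eq.2 (?_ : (y * x)⁻¹ * (x * y) ∈ _)).symm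
  simpa [mul_assoc] using h'

/-- Commuting passes to products and inverses, so generators suffice. There `[x, y] = x⁻¹ · y⁻¹xy`
lies in `R` by normality. -/
theorem commute_mk_of_mem_left {n y : F} (hn : n ∈ valuesIn {u} R)
    (hy : y ∈ verbalSubgroup {w} F) :
    Commute (n : F ⧸ valuesIn {u⁻¹ * w⁻¹ * u * w} R) y := by
  induction hy using Subgroup.closure_induction with
  | one => exact Commute.one_right _
  | mul _ _ _ _ h₁ h₂ => exact h₁.mul_right h₂
  | inv _ _ h => exact h.inv_right
  | mem y hy =>
    induction hn using Subgroup.closure_induction with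
    | one => exact Commute.one_left _
    | mul _ _ _ _ h₁ h₂ => exact h₁.mul_left h₂
    | inv _ _ h => exact h.inv_left
    | mem x hx =>
      refine commute_mk_of_comm_mem hu hw hST R hx.1 hy ?_
      have := R.mul_mem (R.inv_mem hx.2) (hR.conj_mem x hx.2 y⁻¹)
      simpa [mul_assoc] using this

theorem commute_mk_of_mem_right {x m : F} (hx : x ∈ verbalSubgroup {u} F)
    (hm : m ∈ valuesIn {w} R) :
    Commute (x : F ⧸ valuesIn {u⁻¹ * w⁻¹ * u * w} R) m := by
  induction hx using Subgroup.closure_induction with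
  | one => exact Commute.one_left _
  | mul _ _ _ _ h₁ h₂ => exact h₁.mul_left h₂
  | inv _ _ h => exact h.inv_left
  | mem x hx =>
    induction hm using Subgroup.closure_induction with
    | one => exact Commute.one_right _
    | mul _ _ _ _ h₁ h₂ => exact h₁.mul_right h₂
    | inv _ _ h => exact h.inv_right
    | mem y hy =>
      refine commute_mk_of_comm_mem hu hw hST R hx hy.1 ?_
      exact R.mul_mem (hR.conj_mem' _ (R.inv_mem hy.2) x) hy.2

theorem mk_comm_congr {x x' y y' : F} (hx : x ∈ verbalSubgroup {u} F)
    (hy : y ∈ verbalSubgroup {w} F) (hxx' : (x : F ⧸ valuesIn {u} R) = x')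
    (hyy' : (y : F ⧸ valuesIn {w} R) = y') :
    ((x⁻¹ * y⁻¹ * x * y : F) : F ⧸ valuesIn {u⁻¹ * w⁻¹ * u * w} R) =
      (x'⁻¹ * y'⁻¹ * x' * y' : F) := by
  obtain ⟨n, hn, rfl⟩ : ∃ n ∈ valuesIn {u} R, x' = x * n :=
    ⟨x⁻¹ * x', QuotientGroup.eq.1 hxx', by group⟩
  obtain ⟨m, hm, rfl⟩ : ∃ m ∈ valuesIn {w} R, y' = y * m :=
    ⟨y⁻¹ * y', QuotientGroup.eq.1 hyy', by group⟩
  have hy' : y * m ∈ verbalSubgroup {w} F :=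
    mul_mem hy (valuesIn_le_verbalSubgroup _ _ hm)
  -- First `n` is removed with `y * m` kept whole, then `m` is removed from `[x, y * m]`.
  have c₁ := commute_mk_of_mem_left hu hw hST R hn hy'
  have c₂ := commute_mk_of_mem_left hu hw hST R hn
    ((verbalSubgroup_normal {w}).conj_mem' _ hy' x)
  have c₃ := (commute_mk_of_mem_right hu hw hST R
    ((verbalSubgroup_normal {u}).conj_mem' _ hx y) hm).symm
  have e₁ := comm_mul_left_eq (u := (x : F ⧸ valuesIn {u⁻¹ * w⁻¹ * u * w} R)) c₁ c₂
  have e₂ := comm_mul_right_eq (u := (x : F ⧸ valuesIn {u⁻¹ * w⁻¹ * u * w} R)) (w := y) c₃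
  exact (e₁.trans e₂).symm

end Step

/-- Modulo `⟨T(F) ∩ R⟩`, the value of an outer commutator word depends only on the classes of its
entries modulo `R`. -/
theorem mk_lift_congr {S : Finset ℕ} {w : FreeGroup ℕ} (hw : IsOuterCommutatorWord S w)
    (R : Subgroup F) [hR : R.Normal] {f g : ℕ → F} (h : ∀ i, (f i : F ⧸ R) = g i) :
    (FreeGroup.lift f w : F ⧸ valuesIn {w} R) = FreeGroup.lift g w := by
  induction hw with
  | var i =>
    -- Every element is a value of a variable, in particular the discrepancy `(f i)⁻¹ * g i`.
    refine QuotientGroup.eq.2 (Subgroup.subset_closure ⟨⟨_, rfl, fun _ => (f i)⁻¹ * g i, ?_⟩, ?_⟩)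
    · simp
    · simpa using QuotientGroup.eq.1 (h i)
  | comm hu hv hST ihu ihv =>
    simp only [map_mul, map_inv]
    exact mk_comm_congr hu hv hST R (Subgroup.subset_closure (lift_mem_wordValues (Set.mem_singleton _) f))
      (Subgroup.subset_closure (lift_mem_wordValues (Set.mem_singleton _) f)) ihu ihv

/-- Outer commutator words are multiplicative, modulo `⟨T(F) ∩ R⟩`, across two subgroups that
commute modulo `R`. -/
theorem mk_lift_mul {S : Finset ℕ} {w : FreeGroup ℕ} (hw : IsOuterCommutatorWord S w)
    (R : Subgroup F) [hR : R.Normal] {A B : Subgroup F}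
    (hAB : ∀ a ∈ A, ∀ b ∈ B, a⁻¹ * b⁻¹ * a * b ∈ R) {f g : ℕ → F} (hf : ∀ i, f i ∈ A)
    (hg : ∀ i, g i ∈ B) :
    (FreeGroup.lift (fun i => f i * g i) w : F ⧸ valuesIn {w} R) =
      (FreeGroup.lift f w * FreeGroup.lift g w : F) := by
  induction hw with
  | var i => simp
  | @comm S T u v hu hv hST ihu ihv =>
    have hBA : ∀ b ∈ B, ∀ a ∈ A, b⁻¹ * a⁻¹ * b * a ∈ R := fun b hb a ha => by
      have := R.inv_mem (hAB a ha b hb)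
      simpa [mul_assoc] using this
    have val (z : FreeGroup ℕ) (k : ℕ → F) : FreeGroup.lift k z ∈ wordValues {z} F :=
      lift_mem_wordValues (Set.mem_singleton _) k
    have memA (z : FreeGroup ℕ) := lift_mem_of_forall_mem A hf z
    have memB (z : FreeGroup ℕ) := lift_mem_of_forall_mem B hg z
    have conjval (z : FreeGroup ℕ) (x y : F) (hx : x ∈ wordValues {z} F) :
        y⁻¹ * x * y ∈ wordValues {z} F := by
      simpa using conj_mem_wordValues {z} hx y⁻¹
    have e := mk_comm_congr hu hv hST R
      (Subgroup.subset_closure (val u _)) (Subgroup.subset_closure (val v _)) ihu ihv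
    simp only [map_mul, map_inv]
    refine e.trans ?_
    -- Each mixed commutator is a `[u, v]`-value, up to inversion, with one entry in `A` and one in
    -- `B`, so it lies in `R`. Conjugating inside `A` preserves this.
    have c₁ := commute_mk_of_comm_mem hu hv hST R (val u f) (val v g)
      (hAB _ (memA u) _ (memB v))
    have c₂ := (commute_mk_of_comm_mem hu hv hST R (val u g) (val v f)
      (hBA _ (memB u) _ (memA v)))
    have c₃ := commute_mk_of_comm_mem hu hv hST R
      (conjval u _ (FreeGroup.lift f v) (val u f)) (val v g)
      (hAB _ (mul_mem (mul_mem (inv_mem (memA v)) (memA u)) (memA v)) _ (memB v))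
    have c₄ := (commute_mk_of_comm_mem hu hv hST R (val u g)
      (conjval v _ (FreeGroup.lift f u) (val v f))
      (hBA _ (memB u) _ (mul_mem (mul_mem (inv_mem (memA u)) (memA v)) (memA u)))).symm
    exact comm_mul_mul_eq c₁ c₂ c₃ c₄

theorem mk_valuesIn_mono {V W : Set (FreeGroup ℕ)} (h : V ⊆ W) (R : Subgroup F) {x y : F}
    (hxy : (x : F ⧸ valuesIn V R) = y) : (x : F ⧸ valuesIn W R) = y :=
  QuotientGroup.eq.2 (valuesIn_mono h R (QuotientGroup.eq.1 hxy))

end Values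

/-! ### Homomorphisms compared on verbal subgroups -/

section Homs

variable {V : Set (FreeGroup ℕ)} (hV : ∀ w ∈ V, ∃ S : Finset ℕ, IsOuterCommutatorWord S w)
  {F H : Type*} [Group F] [Group H] (R : Subgroup F) [hR : R.Normal]
include hV

/-- Homomorphisms that agree modulo `R` agree on the verbal subgroup modulo `⟨T(F) ∩ R⟩`. -/
theorem mk_map_congr {φ ψ : H →* F} (h : ∀ x, (φ x : F ⧸ R) = ψ x) {x : H}
    (hx : x ∈ verbalSubgroup V H) : (φ x : F ⧸ valuesIn V R) = ψ x := by
  induction hx using Subgroup.closure_induction with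
  | one => simp
  | mul x y _ _ hx hy => simp only [map_mul, QuotientGroup.mk_mul, hx, hy]
  | inv x _ hx => simp only [map_inv, QuotientGroup.mk_inv, hx]
  | mem x hx =>
    obtain ⟨v, hv, f, rfl⟩ := hx
    obtain ⟨S, hS⟩ := hV v hv
    rw [map_lift, map_lift]
    exact mk_valuesIn_mono (Set.singleton_subset_iff.2 hv) R
      (mk_lift_congr hS R fun i => h (f i))

/-- An element commuting with the image of `φ` modulo `R` commutes with the image of the verbal
subgroup modulo `⟨T(F) ∩ R⟩`. -/
theorem commute_mk_map {φ : H →* F} {b : F} (h : ∀ x, Commute (φ x : F ⧸ R) b) {x : H}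
    (hx : x ∈ verbalSubgroup V H) : Commute (φ x : F ⧸ valuesIn V R) b := by
  -- Conjugating `φ` by `b` gives a homomorphism that agrees with `φ` modulo `R`.
  have key := mk_map_congr hV R (φ := (MulAut.conj b).toMonoidHom.comp φ) (ψ := φ)
    (fun y => by
      have := (h y).eq
      simp only [MonoidHom.comp_apply, MulEquiv.coe_toMonoidHom, MulAut.conj_apply,
        QuotientGroup.mk_mul, QuotientGroup.mk_inv]
      rw [← this, mul_inv_cancel_right]) hx
  simp only [MonoidHom.comp_apply, MulEquiv.coe_toMonoidHom, MulAut.conj_apply,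
    QuotientGroup.mk_mul, QuotientGroup.mk_inv] at key
  exact (mul_inv_eq_iff_eq_mul.1 key).symm

/-- If `φ` and `ψ` have images commuting modulo `R` and `x ≡ φ x * ψ x` modulo `R` for all `x`, then
the same congruence holds on the verbal subgroup modulo `⟨T(F) ∩ R⟩`. -/
theorem mk_eq_map_mul_map {φ ψ : F →* F} (hc : ∀ x y, Commute (φ x : F ⧸ R) (ψ y))
    (h : ∀ x : F, (x : F ⧸ R) = (φ x * ψ x : F)) {x : F} (hx : x ∈ verbalSubgroup V F) :
    (x : F ⧸ valuesIn V R) = (φ x * ψ x : F) := by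
  induction hx using Subgroup.closure_induction with
  | one => simp
  | mul x y _ hy' hx hy =>
    -- `x ↦ φ x * ψ x` need not be multiplicative: `φ y` has to move past `ψ x`.
    have c := commute_mk_map hV R (fun z => hc z x) hy'
    rw [QuotientGroup.mk_mul, hx, hy]
    simp only [map_mul, QuotientGroup.mk_mul]
    rw [mul_assoc, ← mul_assoc (ψ x : F ⧸ valuesIn V R), ← c.eq]
    simp only [mul_assoc]
  | inv x hx' hx =>
    have c := commute_mk_map hV R (fun z => hc z x) hx'
    rw [QuotientGroup.mk_inv, hx]
    simp only [map_inv, QuotientGroup.mk_mul, QuotientGroup.mk_inv]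
    rw [c.eq, mul_inv_rev]
  | mem x hx =>
    obtain ⟨v, hv, f, rfl⟩ := hx
    obtain ⟨S, hS⟩ := hV v hv
    refine mk_valuesIn_mono (Set.singleton_subset_iff.2 hv) R ?_
    rw [map_lift, map_lift]
    refine (mk_lift_congr hS R fun i => h (f i)).trans
      (mk_lift_mul hS R (A := φ.range) (B := ψ.range) ?_ (fun i => ⟨_, rfl⟩) fun i => ⟨_, rfl⟩)
    rintro _ ⟨a, rfl⟩ _ ⟨b, rfl⟩
    have := QuotientGroup.eq.1 (hc a b).symm.eq
    simpa [mul_assoc] using this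

end Homs

/-! ### Induced maps and the product decomposition -/

/-- A homomorphism carrying `R` into `R'` induces a map of the associated quotients. -/
noncomputable def BTilde.map (V : Set (FreeGroup ℕ)) {F H : Type*} [Group F] [Group H]
    {R : Subgroup F} [R.Normal] {R' : Subgroup H} [R'.Normal] (φ : F →* H)
    (h : R ≤ R'.comap φ) : BTilde V R →* BTilde V R' :=
  QuotientGroup.map _ _
    ((φ.comp (Subgroup.subtype _)).codRestrict (R' ⊓ verbalSubgroup V H) fun x =>
      ⟨h x.2.1, map_mem_verbalSubgroup φ x.2.2⟩)
    fun _ hx => map_mem_valuesIn φ h hx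

theorem BTilde.map_mk_eq_mk_iff {V : Set (FreeGroup ℕ)} {F H : Type*} [Group F] [Group H]
    {R : Subgroup F} [R.Normal] {R' : Subgroup H} [R'.Normal] {φ : F →* H}
    {h : R ≤ R'.comap φ} {x : ↥(R ⊓ verbalSubgroup V F)} {y : ↥(R' ⊓ verbalSubgroup V H)} :
    BTilde.map V φ h (QuotientGroup.mk x) = QuotientGroup.mk y ↔
      (φ x : H ⧸ valuesIn V R') = (y : H) := by
  refine Iff.trans QuotientGroup.eq (Iff.trans ?_ QuotientGroup.eq.symm)
  exact Iff.rfl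

/-- The only place where freeness of the presenting groups enters. -/
theorem exists_lift_of_surjective {F H G : Type*} [Group F] [IsFreeGroup F] [Group H] [Group G]
    {π : H →* G} (hπ : Function.Surjective π) (ρ : F →* G) :
    ∃ α : F →* H, ∀ x, π (α x) = ρ x := by
  refine ⟨IsFreeGroup.lift fun i => Function.surjInv hπ (ρ (IsFreeGroup.of i)), fun x => ?_⟩
  have h : π.comp (IsFreeGroup.lift fun i => Function.surjInv hπ (ρ (IsFreeGroup.of i))) = ρ := by
    refine IsFreeGroup.ext_hom fun i => ?_
    simp [Function.surjInv_eq hπ]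
  exact DFunLike.congr_fun h x

theorem mk_ker_eq_iff {F G : Type*} [Group F] [Group G] (π : F →* G) {x y : F} :
    (x : F ⧸ π.ker) = y ↔ π x = π y := by
  rw [QuotientGroup.eq, MonoidHom.mem_ker, map_mul, map_inv, inv_mul_eq_one]

end BogomolovInvariant

open BogomolovInvariant in
theorem proposition4p8 (V : Set (FreeGroup ℕ))
    (hV : ∀ w ∈ V, ∃ S : Finset ℕ, BogomolovInvariant.IsOuterCommutatorWord S w)
    {G₁ G₂ F₁ F₂ F : Type*} [Group G₁] [Group G₂]
    [Group F₁] [IsFreeGroup F₁] [Group F₂] [IsFreeGroup F₂] [Group F] [IsFreeGroup F]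
    (π₁ : F₁ →* G₁) (hπ₁ : Function.Surjective π₁)
    (π₂ : F₂ →* G₂) (hπ₂ : Function.Surjective π₂)
    (π : F →* G₁ × G₂) (hπ : Function.Surjective π) :
    Nonempty (BogomolovInvariant.BTilde V π.ker ≃*
      BogomolovInvariant.BTilde V π₁.ker × BogomolovInvariant.BTilde V π₂.ker) := by
  obtain ⟨α₁, hα₁⟩ := exists_lift_of_surjective hπ₁ ((MonoidHom.fst G₁ G₂).comp π)
  obtain ⟨α₂, hα₂⟩ := exists_lift_of_surjective hπ₂ ((MonoidHom.snd G₁ G₂).comp π)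
  obtain ⟨β₁, hβ₁⟩ := exists_lift_of_surjective hπ ((MonoidHom.inl G₁ G₂).comp π₁)
  obtain ⟨β₂, hβ₂⟩ := exists_lift_of_surjective hπ ((MonoidHom.inr G₁ G₂).comp π₂)
  simp only [MonoidHom.comp_apply, MonoidHom.coe_fst, MonoidHom.coe_snd, MonoidHom.inl_apply,
    MonoidHom.inr_apply] at hα₁ hα₂ hβ₁ hβ₂
  have kα₁ : π.ker ≤ π₁.ker.comap α₁ := fun x hx => by
    simp [MonoidHom.mem_ker, hα₁, MonoidHom.mem_ker.1 hx]
  have kα₂ : π.ker ≤ π₂.ker.comap α₂ := fun x hx => by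
    simp [MonoidHom.mem_ker, hα₂, MonoidHom.mem_ker.1 hx]
  have kβ₁ : π₁.ker ≤ π.ker.comap β₁ := fun x hx => by
    simp [MonoidHom.mem_ker, hβ₁, MonoidHom.mem_ker.1 hx]
  have kβ₂ : π₂.ker ≤ π.ker.comap β₂ := fun x hx => by
    simp [MonoidHom.mem_ker, hβ₂, MonoidHom.mem_ker.1 hx]
  refine ⟨MulEquiv.ofBijective ((BTilde.map V α₁ kα₁).prod (BTilde.map V α₂ kα₂)) ⟨?_, ?_⟩⟩
  · refine (injective_iff_map_eq_one _).2 fun q hq => ?_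
    obtain ⟨x, rfl⟩ := QuotientGroup.mk_surjective q
    obtain ⟨hq₁, hq₂⟩ := Prod.mk.inj hq
    have h₁ : α₁ x ∈ valuesIn V π₁.ker :=
      (QuotientGroup.eq_one_iff _).1 (BTilde.map_mk_eq_mk_iff (y := 1).1 hq₁)
    have h₂ : α₂ x ∈ valuesIn V π₂.ker :=
      (QuotientGroup.eq_one_iff _).1 (BTilde.map_mk_eq_mk_iff (y := 1).1 hq₂)
    -- Lifts of `g = (g₁, 1)(1, g₂)`: `x ≡ β₁(α₁ x) β₂(α₂ x)`, and both factors die.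
    have key := mk_eq_map_mul_map hV π.ker (φ := β₁.comp α₁) (ψ := β₂.comp α₂)
      (fun x y => (mk_ker_eq_iff π (x := β₁ (α₁ x) * β₂ (α₂ y))
        (y := β₂ (α₂ y) * β₁ (α₁ x))).2 (by simp [hβ₁, hβ₂]))
      (fun x => (mk_ker_eq_iff π).2 (by simp [hβ₁, hβ₂, hα₁, hα₂])) x.2.2
    have hm : β₁ (α₁ x) * β₂ (α₂ x) ∈ valuesIn V π.ker :=
      mul_mem (map_mem_valuesIn β₁ kβ₁ h₁) (map_mem_valuesIn β₂ kβ₂ h₂)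
    refine (QuotientGroup.eq_one_iff _).2 (?_ : (x : F) ∈ valuesIn V π.ker)
    exact (QuotientGroup.eq_one_iff _).1 (key.trans ((QuotientGroup.eq_one_iff _).2 hm))
  · rintro ⟨q₁, q₂⟩
    obtain ⟨y₁, rfl⟩ := QuotientGroup.mk_surjective q₁
    obtain ⟨y₂, rfl⟩ := QuotientGroup.mk_surjective q₂
    -- Modulo the kernels `αᵢ ∘ βᵢ` is the identity and `αᵢ ∘ βⱼ` is trivial for `i ≠ j`, so `β₁ y₁
    -- * β₂ y₂` is a preimage.
    have e₁₁ := mk_map_congr hV π₁.ker (φ := α₁.comp β₁) (ψ := MonoidHom.id F₁)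
      (fun x => (mk_ker_eq_iff π₁).2 (by simp [hα₁, hβ₁])) y₁.2.2
    have e₁₂ := mk_map_congr hV π₁.ker (φ := α₁.comp β₂) (ψ := 1)
      (fun x => (mk_ker_eq_iff π₁).2 (by simp [hα₁, hβ₂])) y₂.2.2
    have e₂₁ := mk_map_congr hV π₂.ker (φ := α₂.comp β₁) (ψ := 1)
      (fun x => (mk_ker_eq_iff π₂).2 (by simp [hα₂, hβ₁])) y₁.2.2
    have e₂₂ := mk_map_congr hV π₂.ker (φ := α₂.comp β₂) (ψ := MonoidHom.id F₂)
      (fun x => (mk_ker_eq_iff π₂).2 (by simp [hα₂, hβ₂])) y₂.2.2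
    have f₁ : ((α₁ (β₁ y₁ * β₂ y₂) : F₁) : F₁ ⧸ valuesIn V π₁.ker) = (y₁ : F₁) := by
      simpa using congrArg₂ (· * ·) e₁₁ e₁₂
    have f₂ : ((α₂ (β₁ y₁ * β₂ y₂) : F₂) : F₂ ⧸ valuesIn V π₂.ker) = (y₂ : F₂) := by
      simpa using congrArg₂ (· * ·) e₂₁ e₂₂
    refine ⟨QuotientGroup.mk ⟨β₁ y₁ * β₂ y₂,
      mul_mem (kβ₁ y₁.2.1) (kβ₂ y₂.2.1),
      mul_mem (map_mem_verbalSubgroup β₁ y₁.2.2) (map_mem_verbalSubgroup β₂ y₂.2.2)⟩, ?_⟩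
    exact Prod.ext (BTilde.map_mk_eq_mk_iff.2 f₁)
      (BTilde.map_mk_eq_mk_iff.2 f₂)
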